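/- Let $\mathsf{Prop}$ be a countable set of propositional atoms and let formulae be generated by $\phi ::= p \mid \neg\phi \mid \phi\lor\phi \mid \Box\phi$ with $p\in\mathsf{Prop}$. A model is a triple $M=(W,R,V)$ with $W$ a non-empty set, $R\subseteq W\times W$ transitive and conversely well-founded, and $V:\mathsf{Prop}\to 2^W$; satisfaction is defined by $M,w\models p$ iff $w\in V(p)$; $M,w\models\neg\phi$ iff $M,w\not\models\phi$; $M,w\models\phi\lor\psi$ iff $M,w\models\phi$ or $M,w\models\psi$; and $M,w\models\Box\phi$ iff $M,u\models\phi$ for all $u$ with $(w,u)\in R$. A formula $\phi$ is valid iff $M,w\models\phi$ for every model $M$ and every world $w$ of $M$. A linear nested sequent is an expression $\Gamma_1\vdash\Delta_1 \,/\!/\, \cdots \,/\!/\, \Gamma_n\vdash\Delta_n$ with $n\ge 1$ and all $\Gamma_i,\Delta_i$ finite multisets of formulae. The calculus $\mathsf{LNGL}$ has the following rules, where the context $\mathcal{G}$ is a possibly empty sequence of components: - $(\mathsf{id}_1)$ $\mathcal{G}/\!/\Gamma,p\vdash p,\Delta$ is an axiom, for $p\in\mathsf{Prop}$; - $(\mathsf{id}_2)$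 $\mathcal{G}/\!/\Gamma,\Box\phi\vdash\Box\phi,\Delta$ is an axiom; - $(\lor\mathsf{L})$ from $\mathcal{G}/\!/\Gamma,\phi\vdash\Delta$ and $\mathcal{G}/\!/\Gamma,\psi\vdash\Delta$ infer $\mathcal{G}/\!/\Gamma,\phi\lor\psi\vdash\Delta$; - $(\lor\mathsf{R})$ from $\mathcal{G}/\!/\Gamma\vdash\phi,\psi,\Delta$ infer $\mathcal{G}/\!/\Gamma\vdash\phi\lor\psi,\Delta$; - $(\neg\mathsf{L})$ from $\mathcal{G}/\!/\Gamma\vdash\phi,\Delta$ infer $\mathcal{G}/\!/\Gamma,\neg\phi\vdash\Delta$; - $(\neg\mathsf{R})$ from $\mathcal{G}/\!/\Gamma,\phi\vdash\Delta$ infer $\mathcal{G}/\!/\Gamma\vdash\neg\phi,\Delta$; - $(\mathsf{4L})$ from $\mathcal{G}/\!/\Gamma,\Box\phi\vdash\Delta/\!/\Sigma,\Box\phi\vdash\Pi$ infer $\mathcal{G}/\!/\Gamma,\Box\phi\vdash\Delta/\!/\Sigma\vdash\Pi$; - $(\Box\mathsf{L})$ from $\mathcal{G}/\!/\Gamma,\Box\phi\vdash\Delta/\!/\Sigma,\phi\vdash\Pi$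 infer $\mathcal{G}/\!/\Gamma,\Box\phi\vdash\Delta/\!/\Sigma\vdash\Pi$; - $(\Box\mathsf{R})$ from $\mathcal{G}/\!/\Gamma\vdash\Delta/\!/\Box\phi\vdash\phi$ infer $\mathcal{G}/\!/\Gamma\vdash\Box\phi,\Delta$. A linear nested sequent is provable in $\mathsf{LNGL}$ iff it is the conclusion of a finite tree of rule instances all of whose leaves are axioms. **Corollary ($\mathsf{LNGL}$ Soundness and Completeness).** For every formula $\phi$: $\phi$ is valid if and only if the one-component linear nested sequent $\vdash\phi$ is provable in $\mathsf{LNGL}$. -/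

import Mathlib

universe u v

namespace GLLogic

/-- Formulas `φ ::= p | ¬φ | φ ∨ φ | □φ` over a set `Atom` of propositional atoms. -/
inductive Formula (Atom : Type*) where
  | atom (p : Atom) : Formula Atom
  | neg (φ : Formula Atom) : Formula Atom
  | or (φ ψ : Formula Atom) : Formula Atom
  | box (φ : Formula Atom) : Formula Atom

/-- Models: a non-empty set `W` of worlds with a transitive, conversely well-founded
accessibility relation and a valuation. -/
structure Model (Atom : Type*) (W : Type*) where
  nonempty : Nonempty W
  R : W → W → Prop
  trans : ∀ w u v, R w u → R u v → R w v
  conversely_wf : WellFounded (fun u w : W => R w u)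
  V : Atom → Set W

/-- Satisfaction `M, w ⊨ φ`. -/
def Sat {Atom W : Type*} (M : Model Atom W) : W → Formula Atom → Prop
  | w, .atom p => w ∈ M.V p
  | w, .neg φ => ¬ Sat M w φ
  | w, .or φ ψ => Sat M w φ ∨ Sat M w ψ
  | w, .box φ => ∀ u : W, M.R w u → Sat M u φ

/-- Truth of a formula in a model: `M ⊨ φ`. -/
def TrueIn {Atom W : Type*} (M : Model Atom W) (φ : Formula Atom) : Prop :=
  ∀ w : W, Sat M w φ

/-- Validity `⊨ φ`: truth in all models (with worlds in a given universe `u`). -/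
def Valid {Atom : Type v} (φ : Formula Atom) : Prop :=
  ∀ (W : Type u) (M : Model Atom W), TrueIn M φ

/-- A Gentzen sequent `Γ ⊢ Δ` of finite multisets of formulas. -/
structure Sequent (Atom : Type*) where
  ant : Multiset (Formula Atom)
  con : Multiset (Formula Atom)

scoped infix:50 " ⊢ₛ " => Sequent.mk

/-- `Provable 𝒢`: the linear nested sequent `𝒢` has a proof in `LNGL`. A linear nested sequent
`Γ₁ ⊢ Δ₁ // ⋯ // Γₙ ⊢ Δₙ` is the list of its components, from the first to the end component;
the conclusion and premises of every rule have at least one component, and the context `G` of a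
rule may be empty. -/
inductive Provable {Atom : Type*} : List (Sequent Atom) → Prop
  | id₁ (G : List (Sequent Atom)) (Γ Δ : Multiset (Formula Atom)) (p : Atom) :
      Provable (G ++ [.atom p ::ₘ Γ ⊢ₛ .atom p ::ₘ Δ])
  | id₂ (G : List (Sequent Atom)) (Γ Δ : Multiset (Formula Atom)) (φ : Formula Atom) :
      Provable (G ++ [.box φ ::ₘ Γ ⊢ₛ .box φ ::ₘ Δ])
  | orL (G : List (Sequent Atom)) (Γ Δ : Multiset (Formula Atom)) (φ ψ : Formula Atom) :
      Provable (G ++ [φ ::ₘ Γ ⊢ₛ Δ]) →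
      Provable (G ++ [ψ ::ₘ Γ ⊢ₛ Δ]) →
      Provable (G ++ [.or φ ψ ::ₘ Γ ⊢ₛ Δ])
  | orR (G : List (Sequent Atom)) (Γ Δ : Multiset (Formula Atom)) (φ ψ : Formula Atom) :
      Provable (G ++ [Γ ⊢ₛ φ ::ₘ ψ ::ₘ Δ]) →
      Provable (G ++ [Γ ⊢ₛ .or φ ψ ::ₘ Δ])
  | negL (G : List (Sequent Atom)) (Γ Δ : Multiset (Formula Atom)) (φ : Formula Atom) :
      Provable (G ++ [Γ ⊢ₛ φ ::ₘ Δ]) →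
      Provable (G ++ [.neg φ ::ₘ Γ ⊢ₛ Δ])
  | negR (G : List (Sequent Atom)) (Γ Δ : Multiset (Formula Atom)) (φ : Formula Atom) :
      Provable (G ++ [φ ::ₘ Γ ⊢ₛ Δ]) →
      Provable (G ++ [Γ ⊢ₛ .neg φ ::ₘ Δ])
  | fourL (G : List (Sequent Atom)) (Γ Δ Γ' Δ' : Multiset (Formula Atom)) (φ : Formula Atom) :
      Provable (G ++ [.box φ ::ₘ Γ ⊢ₛ Δ, .box φ ::ₘ Γ' ⊢ₛ Δ']) →
      Provable (G ++ [.box φ ::ₘ Γ ⊢ₛ Δ, Γ' ⊢ₛ Δ'])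
  | boxL (G : List (Sequent Atom)) (Γ Δ Γ' Δ' : Multiset (Formula Atom)) (φ : Formula Atom) :
      Provable (G ++ [.box φ ::ₘ Γ ⊢ₛ Δ, φ ::ₘ Γ' ⊢ₛ Δ']) →
      Provable (G ++ [.box φ ::ₘ Γ ⊢ₛ Δ, Γ' ⊢ₛ Δ'])
  | boxR (G : List (Sequent Atom)) (Γ Δ : Multiset (Formula Atom)) (φ : Formula Atom) :
      Provable (G ++ [Γ ⊢ₛ Δ, {.box φ} ⊢ₛ {φ}]) →
      Provable (G ++ [Γ ⊢ₛ .box φ ::ₘ Δ])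

end GLLogic

/-! Soundness: read the components as successive worlds along `R`. Every rule turns a chain refuting
its conclusion into one refuting a premise, and no chain refutes an axiom. Only `boxR` needs
converse well-foundedness (`exists_maximal_of_not_sat_box`). Completeness: search backwards on the
end component alone, inside a finite subformula-closed set. Propositional rules reduce a sequent to
atoms and boxes. Each `□φ` on the right then calls for the sequent of `φ` with the diagonal formula
`□φ` added on the left, so fewer boxes are missing there and the search stops. If one such sequent
is provable, so is the original; if all are refutable, their countermodels are glued under a new
root (`Refutable.of_box`). -/

namespace GLLogic

/-! ### Soundness: refuting chains -/

section Soundness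

variable {Atom : Type*} {W : Type*}

/-- The world `w` of `M` refutes the sequent `s`. -/
def Refutes (M : Model Atom W) (w : W) (s : Sequent Atom) : Prop :=
  (∀ φ ∈ s.ant, Sat M w φ) ∧ ∀ φ ∈ s.con, ¬ Sat M w φ

/-- Some `R`-chain of worlds of `M` that starts in `A` refutes the linear nested sequent,
component by component. -/
def ChainRefutes (M : Model Atom W) : (W → Prop) → List (Sequent Atom) → Prop
  | _, [] => True
  | A, s :: G => ∃ w, A w ∧ Refutes M w s ∧ ChainRefutes M (M.R w) G

variable {M : Model Atom W}

/-- Rules change only the tail of the list. The hypothesis ranges over all `A` because the context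
`G` determines which worlds the tail may start from. -/
theorem ChainRefutes.append_or {T T₁ T₂ : List (Sequent Atom)}
    (h : ∀ A, ChainRefutes M A T → ChainRefutes M A T₁ ∨ ChainRefutes M A T₂) :
    ∀ (G : List (Sequent Atom)) (A : W → Prop), ChainRefutes M A (G ++ T) →
      ChainRefutes M A (G ++ T₁) ∨ ChainRefutes M A (G ++ T₂)
  | [], A, hT => h A hT
  | _ :: G, _, ⟨w, hA, hw, hT⟩ =>
    (append_or h G (M.R w) hT).imp (fun h₁ => ⟨w, hA, hw, h₁⟩) (fun h₂ => ⟨w, hA, hw, h₂⟩)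

theorem ChainRefutes.append_mono {T T' : List (Sequent Atom)}
    (h : ∀ A, ChainRefutes M A T → ChainRefutes M A T') (G : List (Sequent Atom))
    (A : W → Prop) (hT : ChainRefutes M A (G ++ T)) : ChainRefutes M A (G ++ T') :=
  or_self_iff.1 (append_or (fun A hA => Or.inl (h A hA)) G A hT)

theorem not_chainRefutes_append {T : List (Sequent Atom)} (h : ∀ A, ¬ ChainRefutes M A T) :
    ∀ (G : List (Sequent Atom)) (A : W → Prop), ¬ ChainRefutes M A (G ++ T)
  | [], A, hT => h A hT
  | _ :: G, _, ⟨w, _, _, hT⟩ => not_chainRefutes_append h G (M.R w) hT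

/-- In a transitive conversely well-founded model, a false `□φ` is falsified at a successor
where `□φ` holds. -/
theorem exists_maximal_of_not_sat_box {w : W} {φ : Formula Atom} (h : ¬ Sat M w (.box φ)) :
    ∃ u, M.R w u ∧ Sat M u (.box φ) ∧ ¬ Sat M u φ := by
  simp only [Sat, not_forall] at h
  obtain ⟨u, hwu, hu⟩ := h
  -- Minimal for the converse relation: an `R`-last successor of `w` falsifying `φ`.
  obtain ⟨m, ⟨hwm, hm⟩, hmax⟩ :=
    M.conversely_wf.has_min {x | M.R w x ∧ ¬ Sat M x φ} ⟨u, hwu, hu⟩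
  refine ⟨m, hwm, fun x hmx => ?_, hm⟩
  by_contra hx
  exact hmax x ⟨M.trans _ _ _ hwm hmx, hx⟩ hmx

theorem Provable.not_chainRefutes (M : Model Atom W) {L : List (Sequent Atom)}
    (h : Provable L) : ∀ A, ¬ ChainRefutes M A L := by
  induction h with
  | id₁ G Γ Δ p =>
    refine not_chainRefutes_append ?_ G
    rintro A ⟨w, -, ⟨h₁, h₂⟩, -⟩
    exact h₂ (.atom p) (by simp) (h₁ _ (by simp))
  | id₂ G Γ Δ φ =>
    refine not_chainRefutes_append ?_ G
    rintro A ⟨w, -, ⟨h₁, h₂⟩, -⟩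
    exact h₂ (.box φ) (by simp) (h₁ _ (by simp))
  | orL G Γ Δ φ ψ _ _ ih₁ ih₂ =>
    intro A hA
    refine (ChainRefutes.append_or ?_ G A hA).elim (ih₁ A) (ih₂ A)
    rintro A ⟨w, hw, ⟨h₁, h₂⟩, -⟩
    simp only [Multiset.forall_mem_cons] at h₁
    exact h₁.1.imp
      (fun h => ⟨w, hw, ⟨Multiset.forall_mem_cons.2 ⟨h, h₁.2⟩, h₂⟩, trivial⟩)
      (fun h => ⟨w, hw, ⟨Multiset.forall_mem_cons.2 ⟨h, h₁.2⟩, h₂⟩, trivial⟩)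
  | orR G Γ Δ φ ψ _ ih =>
    intro A hA
    refine ih A (ChainRefutes.append_mono ?_ G A hA)
    rintro A ⟨w, hw, ⟨h₁, h₂⟩, -⟩
    refine ⟨w, hw, ⟨h₁, ?_⟩, trivial⟩
    simpa [Sat, and_assoc] using h₂
  | negL G Γ Δ φ _ ih =>
    intro A hA
    refine ih A (ChainRefutes.append_mono ?_ G A hA)
    rintro A ⟨w, hw, ⟨h₁, h₂⟩, -⟩
    simp only [Multiset.forall_mem_cons] at h₁
    exact ⟨w, hw, ⟨h₁.2, Multiset.forall_mem_cons.2 ⟨h₁.1, h₂⟩⟩, trivial⟩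
  | negR G Γ Δ φ _ ih =>
    intro A hA
    refine ih A (ChainRefutes.append_mono ?_ G A hA)
    rintro A ⟨w, hw, ⟨h₁, h₂⟩, -⟩
    simp only [Multiset.forall_mem_cons] at h₂
    exact ⟨w, hw, ⟨Multiset.forall_mem_cons.2 ⟨not_not.1 h₂.1, h₁⟩, h₂.2⟩, trivial⟩
  | fourL G Γ Δ Γ' Δ' φ _ ih =>
    intro A hA
    refine ih A (ChainRefutes.append_mono ?_ G A hA)
    rintro A ⟨w, hw, ⟨h₁, h₂⟩, u, hwu, ⟨h₃, h₄⟩, -⟩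
    have hb : Sat M w (.box φ) := h₁ _ (by simp)
    exact ⟨w, hw, ⟨h₁, h₂⟩, u, hwu, ⟨Multiset.forall_mem_cons.2
      ⟨fun x hx => hb x (M.trans _ _ _ hwu hx), h₃⟩, h₄⟩, trivial⟩
  | boxL G Γ Δ Γ' Δ' φ _ ih =>
    intro A hA
    refine ih A (ChainRefutes.append_mono ?_ G A hA)
    rintro A ⟨w, hw, ⟨h₁, h₂⟩, u, hwu, ⟨h₃, h₄⟩, -⟩
    have hb : Sat M w (.box φ) := h₁ _ (by simp)
    exact ⟨w, hw, ⟨h₁, h₂⟩, u, hwu, ⟨Multiset.forall_mem_cons.2 ⟨hb u hwu, h₃⟩, h₄⟩, trivial⟩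
  | boxR G Γ Δ φ _ ih =>
    intro A hA
    refine ih A (ChainRefutes.append_mono ?_ G A hA)
    rintro A ⟨w, hw, ⟨h₁, h₂⟩, -⟩
    simp only [Multiset.forall_mem_cons] at h₂
    -- The chain grows by a world that satisfies the diagonal formula.
    obtain ⟨u, hwu, hu, hφ⟩ := exists_maximal_of_not_sat_box h₂.1
    exact ⟨w, hw, ⟨h₁, h₂.2⟩, u, hwu, ⟨by simpa using hu, by simpa using hφ⟩, trivial⟩

theorem Provable.sat {φ : Formula Atom} (h : Provable [Sequent.mk 0 {φ}]) (M : Model Atom W)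
    (w : W) : Sat M w φ := by
  by_contra hw
  exact h.not_chainRefutes M (fun _ => True) ⟨w, trivial, ⟨by simp, by simpa using hw⟩, trivial⟩

end Soundness

/-! ### Subformulas and the complexity outside boxes -/

section Subformulas

variable {Atom : Type*}

/-- The set of subformulas. -/
def Formula.subformulas : Formula Atom → Set (Formula Atom)
  | .atom p => {.atom p}
  | .neg φ => insert (.neg φ) φ.subformulas
  | .or φ ψ => insert (.or φ ψ) (φ.subformulas ∪ ψ.subformulas)
  | .box φ => insert (.box φ) φ.subformulas

theorem Formula.self_mem_subformulas (φ : Formula Atom) : φ ∈ φ.subformulas := by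
  cases φ <;> simp [subformulas]

theorem Formula.finite_subformulas (φ : Formula Atom) : φ.subformulas.Finite := by
  induction φ with
  | atom p => exact Set.finite_singleton _
  | neg φ ih => exact ih.insert _
  | or φ ψ ih₁ ih₂ => exact (ih₁.union ih₂).insert _
  | box φ ih => exact ih.insert _

theorem Formula.subformulas_subset {φ ψ : Formula Atom} (h : ψ ∈ φ.subformulas) :
    ψ.subformulas ⊆ φ.subformulas := by
  induction φ with
  | atom p =>
    obtain rfl : ψ = .atom p := h
    exact subset_rfl
  | neg φ ih =>
    rcases h with rfl | h
    · exact subset_rfl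
    · exact (ih h).trans (Set.subset_insert _ _)
  | or φ₁ φ₂ ih₁ ih₂ =>
    rcases h with rfl | h | h
    · exact subset_rfl
    · exact ((ih₁ h).trans Set.subset_union_left).trans (Set.subset_insert _ _)
    · exact ((ih₂ h).trans Set.subset_union_right).trans (Set.subset_insert _ _)
  | box φ ih =>
    rcases h with rfl | h
    · exact subset_rfl
    · exact (ih h).trans (Set.subset_insert _ _)

/-- Closure under immediate subformulas. -/
structure SubformulaClosed (S : Set (Formula Atom)) : Prop where
  neg : ∀ {φ}, .neg φ ∈ S → φ ∈ S
  or_left : ∀ {φ ψ}, .or φ ψ ∈ S → φ ∈ S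
  or_right : ∀ {φ ψ}, .or φ ψ ∈ S → ψ ∈ S
  box : ∀ {φ}, .box φ ∈ S → φ ∈ S

theorem Formula.subformulaClosed_subformulas (φ : Formula Atom) :
    SubformulaClosed φ.subformulas where
  neg {ψ} h := subformulas_subset h (by simp [subformulas, self_mem_subformulas])
  or_left {ψ χ} h := subformulas_subset h (by simp [subformulas, self_mem_subformulas])
  or_right {ψ χ} h := subformulas_subset h (by simp [subformulas, self_mem_subformulas])
  box {ψ} h := subformulas_subset h (by simp [subformulas, self_mem_subformulas])

/-- The number of propositional connectives outside all boxes. -/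
def Formula.depth₀ : Formula Atom → ℕ
  | .atom _ => 0
  | .neg φ => φ.depth₀ + 1
  | .or φ ψ => φ.depth₀ + ψ.depth₀ + 1
  | .box _ => 0

/-- The body of a boxed formula. -/
def Formula.unbox : Formula Atom → Option (Formula Atom)
  | .box φ => some φ
  | _ => none

theorem Formula.unbox_eq_some {φ ψ : Formula Atom} : φ.unbox = some ψ ↔ φ = .box ψ := by
  cases φ <;> simp [unbox]

/-- The bodies of the boxed formulas in a multiset. -/
def boxBodies (Γ : Multiset (Formula Atom)) : Multiset (Formula Atom) :=
  Γ.filterMap Formula.unbox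

theorem mem_boxBodies {Γ : Multiset (Formula Atom)} {ψ : Formula Atom} :
    ψ ∈ boxBodies Γ ↔ .box ψ ∈ Γ := by
  simp [boxBodies, Multiset.mem_filterMap, Formula.unbox_eq_some]

end Subformulas

/-! ### Gluing models under a new root -/

section Glue

variable {Atom : Type v} {ι : Type u} {W : ι → Type u}

/-- Accessibility in the disjoint union of the models `M i` with a new root. -/
def glueRel (M : ∀ i, Model Atom (W i)) (w : ∀ i, W i) :
    Option (Σ i, W i) → Option (Σ i, W i) → Prop
  | none, some ⟨i, x⟩ => x = w i ∨ (M i).R (w i) x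
  | some a, some b => ∃ i x y, a = ⟨i, x⟩ ∧ b = ⟨i, y⟩ ∧ (M i).R x y
  | _, none => False

/-- The disjoint union of the models `M i`, with a new root below each point `w i`. -/
def Model.glue (M : ∀ i, Model Atom (W i)) (w : ∀ i, W i) (V₀ : Set Atom) :
    Model Atom (Option (Σ i, W i)) where
  nonempty := ⟨none⟩
  R := glueRel M w
  trans := by
    rintro (_ | ⟨i, x⟩) (_ | ⟨j, y⟩) (_ | ⟨k, z⟩) h₁ h₂ <;> try exact h₁.elim
    · exact h₂.elim
    · obtain ⟨i, y, z, h, h', h₂⟩ := h₂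
      cases h
      cases h'
      rcases h₁ with rfl | h₁
      · exact .inr h₂
      · exact .inr ((M _).trans _ _ _ h₁ h₂)
    · exact h₂.elim
    · obtain ⟨i, y, z, h, h', h₂⟩ := h₂
      obtain ⟨i, x, y', h₃, h₄, h₁⟩ := h₁
      cases h
      cases h'
      cases h₃
      cases h₄
      exact ⟨_, _, _, rfl, rfl, (M _).trans _ _ _ h₁ h₂⟩
  conversely_wf := by
    -- No arrow leaves a copy of `M i`, so its points inherit accessibility; the root sees only such
    -- points.
    have key : ∀ i x, Acc (fun b a => glueRel M w a b) (some ⟨i, x⟩) := by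
      intro i x
      induction x using (M i).conversely_wf.induction with
      | _ x ih =>
        refine ⟨_, ?_⟩
        rintro (_ | b) h
        · exact h.elim
        · obtain ⟨i, x, y, h, rfl, h'⟩ := h
          cases h
          exact ih y h'
    refine ⟨?_⟩
    rintro (_ | ⟨i, x⟩)
    · refine ⟨_, ?_⟩
      rintro (_ | ⟨i, x⟩) h
      · exact h.elim
      · exact key i x
    · exact key i x
  V p := {a | match a with
    | none => p ∈ V₀
    | some ⟨i, x⟩ => x ∈ (M i).V p}

theorem sat_glue_some (M : ∀ i, Model Atom (W i)) (w : ∀ i, W i) (V₀ : Set Atom) (i : ι)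
    (φ : Formula Atom) (x : W i) :
    Sat (Model.glue M w V₀) (some ⟨i, x⟩) φ ↔ Sat (M i) x φ := by
  induction φ generalizing x with
  | atom p => rfl
  | neg φ ih => exact not_congr (ih x)
  | or φ ψ ih₁ ih₂ => exact or_congr (ih₁ x) (ih₂ x)
  | box φ ih =>
    constructor
    · exact fun h y hy => (ih y).1 (h (some ⟨i, y⟩) ⟨i, x, y, rfl, rfl, hy⟩)
    · rintro h (_ | b) hb
      · exact hb.elim
      · obtain ⟨j, x, y, h', rfl, hy⟩ := hb
        cases h'
        exact (ih y).2 (h y hy)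

theorem sat_glue_none_box (M : ∀ i, Model Atom (W i)) (w : ∀ i, W i) (V₀ : Set Atom)
    (φ : Formula Atom) :
    Sat (Model.glue M w V₀) none (.box φ) ↔ ∀ i, Sat (M i) (w i) φ ∧ Sat (M i) (w i) (.box φ) := by
  constructor
  · exact fun h i => ⟨(sat_glue_some M w V₀ i φ _).1 (h (some ⟨i, w i⟩) (.inl rfl)),
      fun y hy => (sat_glue_some M w V₀ i φ _).1 (h (some ⟨i, y⟩) (.inr hy))⟩
  · rintro h (_ | ⟨i, y⟩) hb
    · exact hb.elim
    · refine (sat_glue_some M w V₀ i φ y).2 ?_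
      rcases hb with rfl | hy
      · exact (h i).1
      · exact (h i).2 y hy

end Glue

/-! ### Completeness: proof search or countermodel -/

section Completeness

variable {Atom : Type v}

/-- Some world of some model refutes the sequent. -/
def Refutable (s : Sequent Atom) : Prop :=
  ∃ (W : Type u) (M : Model Atom W) (w : W), Refutes M w s

/-- The sequent is provable as end component after every context. -/
def EndProvable (s : Sequent Atom) : Prop :=
  ∀ G : List (Sequent Atom), Provable (G ++ [s])

/-- Boxed formulas of the penultimate component can be propagated, with their bodies. -/
theorem Provable.of_propagate {G : List (Sequent Atom)} {Γ Δ Γ' Δ' : Multiset (Formula Atom)}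
    (L : Multiset (Formula Atom)) (hL : ∀ ψ ∈ L, .box ψ ∈ Γ)
    (h : Provable (G ++ [Γ ⊢ₛ Δ, L.map .box + L + Γ' ⊢ₛ Δ'])) :
    Provable (G ++ [Γ ⊢ₛ Δ, Γ' ⊢ₛ Δ']) := by
  induction L using Multiset.induction_on with
  | empty => simpa using h
  | cons ψ L ih =>
    rw [Multiset.forall_mem_cons] at hL
    refine ih hL.2 ?_
    obtain ⟨Γ₀, rfl⟩ := Multiset.exists_cons_of_mem hL.1
    refine Provable.fourL _ _ _ _ _ _ (Provable.boxL _ _ _ _ _ _ ?_)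
    convert h using 5
    simp only [Multiset.map_cons, Multiset.cons_add, Multiset.add_cons]

/-- `boxR` pushes the current component into the context, which is why `EndProvable` quantifies over
all contexts. -/
theorem EndProvable.box {Γ Δ : Multiset (Formula Atom)} {φ : Formula Atom}
    (h : EndProvable ((boxBodies Γ).map .box + boxBodies Γ + {.box φ} ⊢ₛ {φ}))
    (hφ : .box φ ∈ Δ) : EndProvable (Γ ⊢ₛ Δ) := by
  intro G
  obtain ⟨Δ₀, rfl⟩ := Multiset.exists_cons_of_mem hφ
  refine Provable.boxR _ _ _ _
    (Provable.of_propagate (boxBodies Γ) (fun ψ => mem_boxBodies.1) ?_)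
  simpa using h (G ++ [Γ ⊢ₛ Δ₀])

/-- A sequent of atoms and boxes with disjoint sides is refutable as soon as the sequents
obtained from it by the box rule are. -/
theorem Refutable.of_box {Γ Δ : Multiset (Formula Atom)}
    (hΓ : ∀ φ ∈ Γ, φ.depth₀ = 0) (hΔ : ∀ φ ∈ Δ, φ.depth₀ = 0) (hd : ∀ φ ∈ Γ, φ ∉ Δ)
    (h : ∀ φ, .box φ ∈ Δ →
      Refutable.{u, v} ((boxBodies Γ).map .box + boxBodies Γ + {.box φ} ⊢ₛ {φ})) :
    Refutable.{u, v} (Γ ⊢ₛ Δ) := by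
  have hfin : Finite {φ : Formula Atom // .box φ ∈ Δ} := by
    classical
    exact (((boxBodies Δ).toFinset.finite_toSet.subset
      (fun φ hφ => by simpa using mem_boxBodies.2 hφ)) : {φ | Formula.box φ ∈ Δ}.Finite)
  -- Finiteness lets the index type move from the universe of `Atom` to that of the worlds.
  let e := equivShrink.{u} {φ : Formula Atom // .box φ ∈ Δ}
  have h' : ∀ i, Refutable.{u, v}
      ((boxBodies Γ).map .box + boxBodies Γ + {.box (e.symm i).1} ⊢ₛ {(e.symm i).1}) :=
    fun i => h _ (e.symm i).2
  choose W M w hw using h'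
  refine ⟨_, Model.glue M w {p | .atom p ∈ Γ}, none, ?_, ?_⟩
  · rintro (p | φ | ⟨φ, ψ⟩ | φ) hφ
    · exact hφ
    · simpa [Formula.depth₀] using hΓ _ hφ
    · simpa [Formula.depth₀] using hΓ _ hφ
    · rw [sat_glue_none_box]
      intro i
      have hm := mem_boxBodies.2 hφ
      exact ⟨(hw i).1 _ (by simp [hm]), (hw i).1 _ (by simp [hm])⟩
  · rintro (p | φ | ⟨φ, ψ⟩ | φ) hφ
    · exact fun hp => hd _ hp hφ
    · simpa [Formula.depth₀] using hΔ _ hφ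
    · simpa [Formula.depth₀] using hΔ _ hφ
    · rw [sat_glue_none_box]
      intro hs
      have h₁ := (hw (e ⟨φ, hφ⟩)).2 φ (by simp)
      exact h₁ (hs _).1

/-- Boxed formulas of `S` missing from `Γ`. -/
def missingBoxes (S : Set (Formula Atom)) (Γ : Multiset (Formula Atom)) : Set (Formula Atom) :=
  {φ | φ ∈ S ∧ (∃ ψ, φ = .box ψ) ∧ φ ∉ Γ}

/-- Inner induction, on the connectives outside boxes; `step` is the outer hypothesis, used only
when passing to a box premise. -/
theorem endProvable_or_refutable_of_step {S : Set (Formula Atom)} (hc : SubformulaClosed S)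
    {n : ℕ}
    (step : ∀ Γ Δ : Multiset (Formula Atom), (∀ φ ∈ Γ, φ ∈ S) → (∀ φ ∈ Δ, φ ∈ S) →
      (missingBoxes S Γ).ncard < n → EndProvable (Γ ⊢ₛ Δ) ∨ Refutable.{u, v} (Γ ⊢ₛ Δ))
    (hS : S.Finite) (m : ℕ) :
    ∀ Γ Δ : Multiset (Formula Atom), (∀ φ ∈ Γ, φ ∈ S) → (∀ φ ∈ Δ, φ ∈ S) →
      (missingBoxes S Γ).ncard ≤ n → (Γ.map Formula.depth₀).sum + (Δ.map Formula.depth₀).sum = m →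
      EndProvable (Γ ⊢ₛ Δ) ∨ Refutable.{u, v} (Γ ⊢ₛ Δ) := by
  have mono : ∀ {Γ Γ' : Multiset (Formula Atom)}, (∀ ψ, Formula.box ψ ∈ Γ → .box ψ ∈ Γ') →
      (missingBoxes S Γ').ncard ≤ (missingBoxes S Γ).ncard := by
    intro Γ Γ' h
    refine Set.ncard_le_ncard ?_ (hS.subset fun _ h => h.1)
    rintro _ ⟨h₁, ⟨ψ, rfl⟩, h₂⟩
    exact ⟨h₁, ⟨ψ, rfl⟩, fun h₃ => h₂ (h ψ h₃)⟩
  induction m using Nat.strong_induction_on with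
  | _ m ih =>
  intro Γ Δ hΓ hΔ hn hm
  by_cases h₁ : ∃ φ ∈ Γ, φ.depth₀ ≠ 0
  · obtain ⟨φ, hφ, hd⟩ := h₁
    obtain ⟨Γ, rfl⟩ := Multiset.exists_cons_of_mem hφ
    rw [Multiset.forall_mem_cons] at hΓ
    cases φ with
    | atom p => exact absurd rfl hd
    | box φ => exact absurd rfl hd
    | neg φ =>
      simp only [Multiset.map_cons, Multiset.sum_cons, Formula.depth₀] at hm
      refine (ih _ ?_ Γ (φ ::ₘ Δ) hΓ.2 (Multiset.forall_mem_cons.2 ⟨hc.neg hΓ.1, hΔ⟩)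
        ((mono ?_).trans hn) rfl).imp ?_ ?_
      · simp only [Multiset.map_cons, Multiset.sum_cons]
        omega
      · simp
      · exact fun h G => Provable.negL _ _ _ _ (h G)
      · rintro ⟨W, M, w, h, h'⟩
        rw [Multiset.forall_mem_cons] at h'
        exact ⟨W, M, w, Multiset.forall_mem_cons.2 ⟨h'.1, h⟩, h'.2⟩
    | or φ ψ =>
      simp only [Multiset.map_cons, Multiset.sum_cons, Formula.depth₀] at hm
      have H₁ := ih ((Multiset.map Formula.depth₀ (φ ::ₘ Γ)).sum + _)
        (by simp only [Multiset.map_cons, Multiset.sum_cons]; omega) (φ ::ₘ Γ) Δ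
        (Multiset.forall_mem_cons.2 ⟨hc.or_left hΓ.1, hΓ.2⟩) hΔ
        ((mono (by simp +contextual)).trans hn) rfl
      have H₂ := ih ((Multiset.map Formula.depth₀ (ψ ::ₘ Γ)).sum + _)
        (by simp only [Multiset.map_cons, Multiset.sum_cons]; omega) (ψ ::ₘ Γ) Δ
        (Multiset.forall_mem_cons.2 ⟨hc.or_right hΓ.1, hΓ.2⟩) hΔ
        ((mono (by simp +contextual)).trans hn) rfl
      rcases H₁ with H₁ | ⟨W, M, w, h, h'⟩
      · rcases H₂ with H₂ | ⟨W, M, w, h, h'⟩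
        · exact .inl fun G => Provable.orL _ _ _ _ _ (H₁ G) (H₂ G)
        · rw [Multiset.forall_mem_cons] at h
          exact .inr ⟨W, M, w, Multiset.forall_mem_cons.2 ⟨.inr h.1, h.2⟩, h'⟩
      · rw [Multiset.forall_mem_cons] at h
        exact .inr ⟨W, M, w, Multiset.forall_mem_cons.2 ⟨.inl h.1, h.2⟩, h'⟩
  by_cases h₂ : ∃ φ ∈ Δ, φ.depth₀ ≠ 0
  · obtain ⟨φ, hφ, hd⟩ := h₂
    obtain ⟨Δ, rfl⟩ := Multiset.exists_cons_of_mem hφ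
    rw [Multiset.forall_mem_cons] at hΔ
    cases φ with
    | atom p => exact absurd rfl hd
    | box φ => exact absurd rfl hd
    | neg φ =>
      simp only [Multiset.map_cons, Multiset.sum_cons, Formula.depth₀] at hm
      refine (ih _ ?_ (φ ::ₘ Γ) Δ (Multiset.forall_mem_cons.2 ⟨hc.neg hΔ.1, hΓ⟩) hΔ.2
        ((mono ?_).trans hn) rfl).imp ?_ ?_
      · simp only [Multiset.map_cons, Multiset.sum_cons]
        omega
      · simp +contextual
      · exact fun h G => Provable.negR _ _ _ _ (h G)
      · rintro ⟨W, M, w, h, h'⟩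
        rw [Multiset.forall_mem_cons] at h
        exact ⟨W, M, w, h.2, Multiset.forall_mem_cons.2 ⟨not_not.2 h.1, h'⟩⟩
    | or φ ψ =>
      simp only [Multiset.map_cons, Multiset.sum_cons, Formula.depth₀] at hm
      refine (ih _ ?_ Γ (φ ::ₘ ψ ::ₘ Δ) hΓ (Multiset.forall_mem_cons.2 ⟨hc.or_left hΔ.1,
        Multiset.forall_mem_cons.2 ⟨hc.or_right hΔ.1, hΔ.2⟩⟩) hn rfl).imp ?_ ?_
      · simp only [Multiset.map_cons, Multiset.sum_cons]
        omega
      · exact fun h G => Provable.orR _ _ _ _ _ (h G)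
      · rintro ⟨W, M, w, h, h'⟩
        simp only [Multiset.forall_mem_cons] at h'
        exact ⟨W, M, w, h, Multiset.forall_mem_cons.2 ⟨not_or.2 ⟨h'.1, h'.2.1⟩, h'.2.2⟩⟩
  push Not at h₁ h₂
  by_cases hd : ∃ φ ∈ Γ, φ ∈ Δ
  · obtain ⟨φ, hφ, hφ'⟩ := hd
    left
    intro G
    have hd := h₁ φ hφ
    obtain ⟨Γ, rfl⟩ := Multiset.exists_cons_of_mem hφ
    obtain ⟨Δ, rfl⟩ := Multiset.exists_cons_of_mem hφ'
    cases φ with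
    | atom p => exact Provable.id₁ _ _ _ _
    | box φ => exact Provable.id₂ _ _ _ _
    | neg φ => simp [Formula.depth₀] at hd
    | or φ ψ => simp [Formula.depth₀] at hd
  push Not at hd
  by_cases hp : ∃ φ, .box φ ∈ Δ ∧
      EndProvable ((boxBodies Γ).map .box + boxBodies Γ + {.box φ} ⊢ₛ {φ})
  · obtain ⟨φ, hφ, hp⟩ := hp
    exact .inl (hp.box hφ)
  push Not at hp
  refine .inr (Refutable.of_box h₁ h₂ hd fun φ hφ => (step _ _ ?_ ?_ ?_).resolve_left (hp φ hφ))
  · intro ψ hψ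
    simp only [Multiset.mem_add, Multiset.mem_map, mem_boxBodies, Multiset.mem_singleton] at hψ
    rcases hψ with (⟨χ, hχ, rfl⟩ | hψ) | rfl
    · exact hΓ _ hχ
    · exact hc.box (hΓ _ hψ)
    · exact hΔ _ hφ
  · simpa using hc.box (hΔ _ hφ)
  -- `□φ` lies in `Δ`, hence not in `Γ` by disjointness, but it is in the new antecedent: the count
  -- drops strictly.
  · refine lt_of_lt_of_le (Set.ncard_lt_ncard ?_ (hS.subset fun _ h => h.1)) hn
    refine (Set.ssubset_iff_of_subset ?_).2
      ⟨.box φ, ⟨hΔ _ hφ, ⟨φ, rfl⟩, fun h => hd _ h hφ⟩, fun h => h.2.2 (by simp)⟩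
    rintro _ ⟨h₁, ⟨ψ, rfl⟩, h₂⟩
    exact ⟨h₁, ⟨ψ, rfl⟩, fun h₃ => h₂ (by simp [mem_boxBodies, h₃])⟩

theorem endProvable_or_refutable {S : Set (Formula Atom)} (hc : SubformulaClosed S)
    (hS : S.Finite) (n : ℕ) :
    ∀ Γ Δ : Multiset (Formula Atom), (∀ φ ∈ Γ, φ ∈ S) → (∀ φ ∈ Δ, φ ∈ S) →
      (missingBoxes S Γ).ncard < n → EndProvable (Γ ⊢ₛ Δ) ∨ Refutable.{u, v} (Γ ⊢ₛ Δ) := by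
  induction n with
  | zero => exact fun _ _ _ _ h => absurd h (Nat.not_lt_zero _)
  | succ n ih =>
    exact fun Γ Δ hΓ hΔ h =>
      endProvable_or_refutable_of_step hc ih hS _ Γ Δ hΓ hΔ (Nat.lt_succ_iff.1 h) rfl

theorem Valid.provable {φ : Formula Atom} (h : Valid.{u, v} φ) :
    Provable [Sequent.mk 0 {φ}] := by
  -- The bound `_` is the number of missing boxes plus one.
  rcases endProvable_or_refutable.{u, v} φ.subformulaClosed_subformulas φ.finite_subformulas _
    0 {φ} (by simp) (by simpa using φ.self_mem_subformulas) (Nat.lt_succ_self _) with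
    hp | ⟨W, M, w, -, hw⟩
  · exact hp []
  · exact absurd (h W M w) (hw φ (by simp))

end Completeness

end GLLogic

theorem mainTheorem6 {Atom : Type v} [Countable Atom] (φ : GLLogic.Formula Atom) :
    GLLogic.Valid.{u, v} φ ↔
      GLLogic.Provable [GLLogic.Sequent.mk (0 : Multiset (GLLogic.Formula Atom)) {φ}] :=
  ⟨fun h => h.provable, fun h _ M w => h.sat M w⟩
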